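/- Let $d\ge 1$ and $S\subseteq\mathbb R^d$. Definitions. (i) For a nonempty family $\mathcal F$ of sets, the Helly number $h(\mathcal F)$ is $0$ if $\mathcal F=\{\emptyset\}$; otherwise it is the least integer $k\ge 1$ such that for all $m\ge 1$ and all $F_1,\dots,F_m\in\mathcal F$ with $F_1\cap\dots\cap F_m=\emptyset$ there are (not necessarily distinct) indices $i_1,\dots,i_k\in\{1,\dots,m\}$ with $F_{i_1}\cap\dots\cap F_{i_k}=\emptyset$, and it is $+\infty$ if no such $k$ exists. Put $h(S):=h(\{S\cap K : K\subseteq\mathbb R^d \text{ convex}\})$. (ii) A set $L\subseteq\mathbb R^d$ is $S$-free if it is closed and convex and its interior is disjoint from $S$; it is maximal $S$-free if moreover no $S$-free set properly contains it. Put $f(S):=-\infty$ if there is no $d$-dimensional maximal $S$-free set. Otherwise let $f(S)$ be the least integer $k\ge 0$ such that every $d$-dimensional maximal $S$-free set is a polyhedron with at most $k$ facets, and $f(S):=+\infty$ if there is no such $k$. Theorem. Let $S\subseteq\mathbb R^d$ be closed and let $C\subseteq\mathbb R^d$ be nonempty and convex. Let $C+S=\{c+s : c\in C,\ s\in S\}$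 be the Minkowski sum and $\dim C$ the dimension of the affine hull of $C$. Then $$h(C+S)\le(\dim C+1)\,h(S)\qquad\text{and}\qquad f(C+S)\le f(S),$$ where $(\dim C+1)\cdot(+\infty)=+\infty$ and $-\infty<k<+\infty$ for all integers $k$. -/

import Mathlib

open scoped Pointwise

namespace HellyFacet

/-- Dimension of a nonempty set: the dimension of its affine hull. -/
noncomputable def dim {d : ℕ} (A : Set (EuclideanSpace ℝ (Fin d))) : ℕ :=
  Module.finrank ℝ (affineSpan ℝ A).direction

/-- Helly condition with parameter `k`: whenever finitely many members (at least one, and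
repetitions are allowed) of the family have empty intersection, some `k` of them, again with
repetitions allowed, have empty intersection. -/
def HellyCondition {α : Type*} (𝓕 : Set (Set α)) (k : ℕ) : Prop :=
  ∀ m : ℕ, 1 ≤ m → ∀ F : Fin m → Set α, (∀ i, F i ∈ 𝓕) → (⋂ i, F i) = ∅ →
    ∃ i : Fin k → Fin m, (⋂ j, F (i j)) = ∅

open Classical in
/-- Helly number of a family of sets: `0` for the family `{∅}`, otherwise the least `k ≥ 1`
satisfying the Helly condition, and `⊤` if there is no such `k`. -/
noncomputable def hellyNumber {α : Type*} (𝓕 : Set (Set α)) : ℕ∞ :=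
  if 𝓕 = {∅} then 0
  else sInf {n : ℕ∞ | ∃ k : ℕ, 1 ≤ k ∧ HellyCondition 𝓕 k ∧ n = (k : ℕ∞)}

/-- The `S`-convex sets: intersections of `S` with convex sets. -/
def convexTraces {d : ℕ} (S : Set (EuclideanSpace ℝ (Fin d))) :
    Set (Set (EuclideanSpace ℝ (Fin d))) :=
  {A | ∃ K : Set (EuclideanSpace ℝ (Fin d)), Convex ℝ K ∧ A = S ∩ K}

/-- `h(S)`: the Helly number of the family of all `S`-convex sets. -/
noncomputable def h {d : ℕ} (S : Set (EuclideanSpace ℝ (Fin d))) : ℕ∞ :=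
  hellyNumber (convexTraces S)

/-- `S`-free sets. -/
def IsFree {d : ℕ} (S L : Set (EuclideanSpace ℝ (Fin d))) : Prop :=
  IsClosed L ∧ Convex ℝ L ∧ Disjoint (interior L) S

/-- Maximal `S`-free sets of full dimension `d`. -/
def IsFullDimMaximalFree {d : ℕ} (S L : Set (EuclideanSpace ℝ (Fin d))) : Prop :=
  Maximal (IsFree S) L ∧ L.Nonempty ∧ dim L = d

/-- Polyhedra: solution sets of finitely many (possibly no) linear inequalities. -/
def IsPolyhedron {d : ℕ} (P : Set (EuclideanSpace ℝ (Fin d))) : Prop :=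
  ∃ (m : ℕ) (u : Fin m → EuclideanSpace ℝ (Fin d)) (β : Fin m → ℝ),
    P = {x | ∀ i, inner ℝ (u i) x ≤ β i}

/-- The facets of a polyhedron `P`: its nonempty faces (sets of maximizers over `P` of a linear
functional) of dimension `dim P - 1`. -/
def facets {d : ℕ} (P : Set (EuclideanSpace ℝ (Fin d))) :
    Set (Set (EuclideanSpace ℝ (Fin d))) :=
  {F | F.Nonempty ∧ IsExposed ℝ P F ∧ dim F + 1 = dim P}

/-- Every `d`-dimensional maximal `S`-free set is a polyhedron with at most `k` facets. -/
def FacetBound {d : ℕ} (S : Set (EuclideanSpace ℝ (Fin d))) (k : ℕ) : Prop :=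
  ∀ L, IsFullDimMaximalFree S L → IsPolyhedron L ∧ (facets L).encard ≤ (k : ℕ∞)

open Classical in
/-- `f(S)`: `-∞` (that is, `⊥`) if there is no `d`-dimensional maximal `S`-free set, otherwise the
least `k` such that each of these sets is a polyhedron with at most `k` facets, and `+∞` (that is,
`⊤`) if there is no such `k`. -/
noncomputable def f {d : ℕ} (S : Set (EuclideanSpace ℝ (Fin d))) : WithBot ℕ∞ :=
  if ∃ L, IsFullDimMaximalFree S L then
    ((sInf {n : ℕ∞ | ∃ k : ℕ, FacetBound S k ∧ n = (k : ℕ∞)} : ℕ∞) : WithBot ℕ∞)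
  else ⊥

end HellyFacet

namespace HellyFacet

open Topology

variable {d : ℕ}

local notation "𝔼" => EuclideanSpace ℝ (Fin d)

/-! Helly number. Let the traces of `K i` on `C + S` have empty intersection. For each `(dim C +
1)`-tuple `J` of indices, the points `s` for which some `c ∈ C` puts `c + s` in every `K (J j)` form
a convex set `P J`. A point of `S` in all `P J` would, by Helly's theorem in the affine hull of `C`,
give one `c` with `c + s` in all `K i`. So some `k` of the traces of `P J` on `S` have empty
intersection, and the `(dim C + 1) * k` indices occurring in these tuples suffice
(`hellyCondition_add`).

Facets. If `L` is maximal `(C + S)`-free, the open convex set `interior L - C` misses `S`, so it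
lies in a maximal `S`-free `M`. The erosion of `M` by `C` is `(C + S)`-free and contains `L`, hence
equals `L` (`exists_eq_erosion`). Describe `M` by at most as many inequalities as it has facets;
erosion only shifts their right-hand sides, so `L` has no more facets than that (`facetBound_add`).
-/

/-! ### The Helly number of a Minkowski sum -/

lemma exists_fin_of_hellyCondition {α ι : Type*} [Finite ι] [Nonempty ι] {𝓕 : Set (Set α)} {k : ℕ}
    (hk : HellyCondition 𝓕 k) (F : ι → Set α) (hF : ∀ i, F i ∈ 𝓕) (he : (⋂ i, F i) = ∅) :
    ∃ i : Fin k → ι, (⋂ j, F (i j)) = ∅ := by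
  obtain ⟨m, ⟨e⟩⟩ := Finite.exists_equiv_fin ι
  have hm : 1 ≤ m := by
    have : Nonempty (Fin m) := e.nonempty_congr.1 inferInstance
    exact Fin.pos_iff_nonempty.2 this
  obtain ⟨i, hi⟩ := hk m hm (fun j => F (e.symm j)) (fun j => hF _)
    (by rw [← he]; exact e.symm.surjective.iInter_comp F)
  exact ⟨fun j => e.symm (i j), hi⟩

/-- Helly's theorem relative to the affine hull of a convex set `C`. -/
lemma exists_mem_forall_of_forall_fin {C : Set 𝔼} (hC : Convex ℝ C)
    (hCne : C.Nonempty) {m : ℕ} (K : Fin m → Set 𝔼)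
    (hK : ∀ i, Convex ℝ (K i))
    (H : ∀ J : Fin (dim C + 1) → Fin m, ∃ c ∈ C, ∀ j, c ∈ K (J j)) :
    ∃ c ∈ C, ∀ i, c ∈ K i := by
  obtain ⟨c₀, hc₀⟩ := hCne
  rcases Nat.eq_zero_or_pos m with rfl | hm
  · exact ⟨c₀, hc₀, fun i => i.elim0⟩
  have key : ∀ I : Finset (Fin m), I.Nonempty → I.card ≤ dim C + 1 →
      ∃ c ∈ C, ∀ i ∈ I, c ∈ K i := by
    intro I hI hcard
    have : Nonempty I := hI.to_subtype
    obtain ⟨g⟩ := Function.Embedding.nonempty_of_card_le (α := I) (β := Fin (dim C + 1))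
      (by simpa using hcard)
    obtain ⟨c, hc, hcK⟩ := H fun j => (Function.invFun g j : I)
    refine ⟨c, hc, fun i hi => ?_⟩
    -- The left inverse of `g` lists `I` with repetitions, so `H` also covers smaller `I`.
    obtain ⟨j, hj⟩ := Function.invFun_surjective g.injective ⟨i, hi⟩
    simpa [hj] using hcK j
  -- Translation by `c₀` moves the problem into the direction space, of dimension `dim C`.
  obtain ⟨v, hv⟩ := Convex.helly_theorem' (𝕜 := ℝ) (E := (affineSpan ℝ C).direction)
    (F := fun i => {v | (v : 𝔼) + c₀ ∈ C ∩ K i}) (s := Finset.univ)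
    (fun i _ => by
      intro x hx y hy a b ha hb hab
      have := (hC.inter (hK i)) hx hy ha hb hab
      simp only [Set.mem_ofPred_eq]
      convert this using 1
      have : c₀ = (a + b) • c₀ := by rw [hab, one_smul]
      push_cast
      nth_rewrite 1 [this]
      module)
    (fun I _ hcard => by
      rcases I.eq_empty_or_nonempty with rfl | hI
      · simp
      obtain ⟨c, hc, hcK⟩ := key I hI hcard
      refine ⟨⟨c - c₀, AffineSubspace.vsub_mem_direction (subset_affineSpan ℝ C hc)
        (subset_affineSpan ℝ C hc₀)⟩, ?_⟩
      simp only [Set.mem_iInter, Set.mem_ofPred_eq, sub_add_cancel]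
      exact fun i hi => ⟨hc, hcK i hi⟩)
  simp only [Finset.mem_univ, Set.iInter_true, Set.mem_iInter, Set.mem_ofPred_eq] at hv
  exact ⟨_, (hv ⟨0, hm⟩).1, fun i => (hv i).2⟩

lemma hellyCondition_add {S C : Set 𝔼} (hC : Convex ℝ C)
    (hCne : C.Nonempty) {k : ℕ} (hk : HellyCondition (convexTraces S) k) :
    HellyCondition (convexTraces (C + S)) ((dim C + 1) * k) := by
  intro m hm F hF he
  choose K hK hFK using hF
  have : Nonempty (Fin m) := ⟨⟨0, hm⟩⟩
  let P : (Fin (dim C + 1) → Fin m) → Set 𝔼 :=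
    fun J => {s | ∃ c ∈ C, ∀ j, c + s ∈ K (J j)}
  have hP : ∀ J, Convex ℝ (P J) := by
    rintro J x ⟨c, hc, hcx⟩ y ⟨e, he, hey⟩ a b ha hb hab
    refine ⟨a • c + b • e, hC hc he ha hb hab, fun j => ?_⟩
    convert hK (J j) (hcx j) (hey j) ha hb hab using 1
    module
  obtain ⟨J, hJ⟩ := exists_fin_of_hellyCondition hk (fun J => S ∩ P J) (fun J => ⟨P J, hP J, rfl⟩)
    (by
      refine Set.eq_empty_iff_forall_notMem.2 fun s hs => ?_
      rw [Set.mem_iInter] at hs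
      obtain ⟨c, hc, hcK⟩ := exists_mem_forall_of_forall_fin hC hCne
        (fun i => (fun c => c + s) ⁻¹' K i) (fun i => (hK i).translate_preimage_left s)
        (fun J => (hs J).2)
      refine Set.eq_empty_iff_forall_notMem.1 he (c + s) (Set.mem_iInter.2 fun i => ?_)
      rw [hFK i]
      exact ⟨Set.add_mem_add hc (hs fun _ => ⟨0, hm⟩).1, hcK i⟩)
  refine ⟨fun p => J (finProdFinEquiv.symm p).2 (finProdFinEquiv.symm p).1, ?_⟩
  refine Set.eq_empty_iff_forall_notMem.2 fun x hx => ?_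
  rw [Set.mem_iInter] at hx
  have hx' : ∀ i j, x ∈ F (J j i) := fun i j => by simpa using hx (finProdFinEquiv (i, j))
  -- An intersection over `Fin 0` is the whole space, so `k = 0` contradicts `hJ`.
  rcases Nat.eq_zero_or_pos k with rfl | hk0
  · simp at hJ
  have hxCS : x ∈ C + S := by
    have := hx' 0 ⟨0, hk0⟩
    rw [hFK] at this
    exact this.1
  obtain ⟨c, hc, s, hs, rfl⟩ := hxCS
  refine Set.eq_empty_iff_forall_notMem.1 hJ s (Set.mem_iInter.2 fun j => ⟨hs, c, hc, fun i => ?_⟩)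
  have := hx' i j
  rw [hFK] at this
  exact this.2

lemma convexTraces_ne_singleton_empty {S : Set 𝔼} (hS : S.Nonempty) :
    convexTraces S ≠ {∅} := by
  intro h
  have : S ∈ convexTraces S := ⟨Set.univ, convex_univ, by simp⟩
  rw [h] at this
  exact hS.ne_empty this

lemma h_empty : h (∅ : Set 𝔼) = 0 := by
  have : convexTraces (∅ : Set 𝔼) = {∅} := by
    ext A
    simp only [convexTraces, Set.empty_inter, Set.mem_ofPred_eq, Set.mem_singleton_iff]
    exact ⟨fun ⟨_, _, h⟩ => h, fun h => ⟨Set.univ, convex_univ, h⟩⟩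
  simp [h, hellyNumber, this]

theorem h_add_le {S C : Set 𝔼} (hC : Convex ℝ C) (hCne : C.Nonempty) :
    h (C + S) ≤ ((dim C + 1 : ℕ) : ℕ∞) * h S := by
  rcases S.eq_empty_or_nonempty with rfl | hS
  · simp [h_empty]
  unfold h hellyNumber
  rw [if_neg (convexTraces_ne_singleton_empty hS),
    if_neg (convexTraces_ne_singleton_empty (hCne.add hS))]
  set A := {n : ℕ∞ | ∃ k : ℕ, 1 ≤ k ∧ HellyCondition (convexTraces S) k ∧ n = (k : ℕ∞)}
  rcases A.eq_empty_or_nonempty with h0 | h0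
  · rw [h0, sInf_empty, ENat.mul_top (Nat.cast_ne_zero.2 (Nat.succ_ne_zero _))]
    exact le_top
  · obtain ⟨k, hk1, hk, hkA⟩ := csInf_mem h0
    rw [hkA]
    exact sInf_le ⟨(dim C + 1) * k, Nat.mul_pos (Nat.succ_pos _) hk1, hellyCondition_add hC hCne hk,
      by push_cast; rfl⟩

/-! ### Facets and inequalities of full-dimensional polyhedra -/

lemma dim_eq_of_interior_nonempty {A : Set 𝔼} (hA : (interior A).Nonempty) : dim A = d := by
  have h1 : affineSpan ℝ A = ⊤ :=
    top_le_iff.1 ((isOpen_interior.affineSpan_eq_top hA).symm.le.trans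
      (affineSpan_mono ℝ interior_subset))
  rw [dim, h1, AffineSubspace.direction_top, finrank_top, finrank_euclideanSpace_fin]

lemma interior_nonempty_of_dim_eq {A : Set 𝔼} (hc : Convex ℝ A) (hA : A.Nonempty)
    (hd : dim A = d) : (interior A).Nonempty := by
  rw [hc.interior_nonempty_iff_affineSpan_eq_top,
    ← AffineSubspace.direction_eq_top_iff_of_nonempty ((affineSpan_nonempty ℝ).2 hA)]
  apply Submodule.eq_top_of_finrank_eq
  rw [finrank_euclideanSpace_fin]
  exact hd

lemma finrank_orthogonal_span_singleton_add_one {u : 𝔼} (hu : u ≠ 0) :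
    Module.finrank ℝ (ℝ ∙ u)ᗮ + 1 = d := by
  have := (ℝ ∙ u).finrank_add_finrank_orthogonal
  rw [finrank_span_singleton hu, finrank_euclideanSpace_fin] at this
  omega

/-- A linear functional attaining its maximum over `A` at an interior point vanishes. -/
lemma eq_zero_of_forall_le_of_mem_interior {A : Set 𝔼} {x : 𝔼} (hx : x ∈ interior A)
    (l : 𝔼 →L[ℝ] ℝ) (hl : ∀ y ∈ A, l y ≤ l x) : l = 0 := by
  have hmax : IsLocalMax l x := Filter.mem_of_superset (mem_interior_iff_mem_nhds.1 hx) hl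
  exact hmax.hasFDerivAt_eq_zero l.hasFDerivAt

lemma eventually_inner_le {u x : 𝔼} {b : ℝ} (h : inner ℝ u x < b) :
    ∀ᶠ y in 𝓝 x, inner ℝ u y ≤ b := by
  have hc : Continuous fun y : 𝔼 => inner ℝ u y := by fun_prop
  exact (hc.tendsto x).eventually_le_const h

lemma inner_eq_zero_of_mem_vectorSpan {A : Set 𝔼} {l : 𝔼 →L[ℝ] ℝ} {b : ℝ}
    (h : ∀ x ∈ A, l x = b) {v : 𝔼} (hv : v ∈ vectorSpan ℝ A) : l v = 0 := by
  have : vectorSpan ℝ A ≤ LinearMap.ker (l : 𝔼 →ₗ[ℝ] ℝ) := by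
    refine Submodule.span_le.2 ?_
    rintro _ ⟨x, hx, y, hy, rfl⟩
    simp [h x hx, h y hy]
  simpa using this hv

lemma vectorSpan_le_orthogonal {A : Set 𝔼} {u : 𝔼} {b : ℝ} (h : ∀ x ∈ A, inner ℝ u x = b) :
    vectorSpan ℝ A ≤ (ℝ ∙ u)ᗮ := fun v hv =>
  (Submodule.mem_orthogonal_singleton_iff_inner_right).2
    (inner_eq_zero_of_mem_vectorSpan (l := innerSL ℝ u) (by simpa using h) hv)

/-- Midpoints preserve strictness gained at either endpoint. -/
lemma exists_forall_lt_of_convex {m : ℕ} {u : Fin m → 𝔼} {β : Fin m → ℝ} {F : Set 𝔼}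
    (hF : Convex ℝ F) (hne : F.Nonempty) (hle : ∀ x ∈ F, ∀ i, inner ℝ (u i) x ≤ β i)
    (p : Fin m → Prop) (H : ∀ i, p i → ∃ x ∈ F, inner ℝ (u i) x < β i) (s : Finset (Fin m)) :
    ∃ x ∈ F, ∀ i ∈ s, p i → inner ℝ (u i) x < β i := by
  classical
  induction s using Finset.induction_on with
  | empty => exact ⟨hne.some, hne.some_mem, by simp⟩
  | insert a s _ ih =>
    obtain ⟨x, hx, hxs⟩ := ih
    by_cases ha : p a
    · obtain ⟨y, hy, hya⟩ := H a ha
      refine ⟨(1 / 2 : ℝ) • x + (1 / 2 : ℝ) • y,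
        hF hx hy (by norm_num) (by norm_num) (by norm_num), fun i hi hp => ?_⟩
      rw [inner_add_right, inner_smul_right, inner_smul_right]
      rcases Finset.mem_insert.1 hi with rfl | hi
      · linarith [hle x hx i]
      · linarith [hxs i hi hp, hle y hy i]
    · refine ⟨x, hx, fun i hi hp => ?_⟩
      rcases Finset.mem_insert.1 hi with rfl | hi
      · exact absurd hp ha
      · exact hxs i hi hp

/-- If no constraint with nonzero normal were tight on all of `F`, some point of `F` would be
interior to `P`, forcing the exposing functional to vanish and `F = P`. A tight one contains `F` in
a hyperplane of the same dimension, on which the exposing functional is constant. -/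
lemma exists_eq_of_mem_facets {m : ℕ} {u : Fin m → 𝔼} {β : Fin m → ℝ} {P : Set 𝔼}
    (hP : P = {x | ∀ i, inner ℝ (u i) x ≤ β i}) (hint : (interior P).Nonempty)
    {F : Set 𝔼} (hF : F ∈ facets P) : ∃ i, F = {x ∈ P | inner ℝ (u i) x = β i} := by
  obtain ⟨hne, hexp, hdim⟩ := hF
  have hPd := dim_eq_of_interior_nonempty hint
  have hPc : Convex ℝ P := by
    rw [hP, Set.ofPred_forall]
    exact convex_iInter fun i => convex_halfSpace_le (innerₛₗ ℝ (u i)).isLinear _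
  have hmem : ∀ x ∈ P, ∀ i, inner ℝ (u i) x ≤ β i := fun x hx => by rw [hP] at hx; exact hx
  have hFP : F ⊆ P := hexp.subset
  have hFc : Convex ℝ F := hexp.convex hPc
  obtain ⟨l, hl⟩ := hexp hne
  obtain ⟨i, hui, hi⟩ : ∃ i, u i ≠ 0 ∧ ∀ x ∈ F, inner ℝ (u i) x = β i := by
    by_contra! hcon
    obtain ⟨x, hx, hxs⟩ := exists_forall_lt_of_convex hFc hne (fun x hx => hmem x (hFP hx))
      (fun i => u i ≠ 0) (fun i hi => by
        obtain ⟨x, hx, hxi⟩ := hcon i hi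
        exact ⟨x, hx, lt_of_le_of_ne (hmem x (hFP hx) i) hxi⟩) Finset.univ
    have hxint : x ∈ interior P := by
      rw [mem_interior_iff_mem_nhds, hP]
      refine Filter.eventually_all.2 fun i => ?_
      by_cases hui : u i = 0
      · refine Filter.Eventually.of_forall fun y => ?_
        simpa [hui] using hmem x (hFP hx) i
      · exact eventually_inner_le (hxs i (Finset.mem_univ _) hui)
    have hl0 : l = 0 := by
      rw [hl] at hx
      exact eq_zero_of_forall_le_of_mem_interior hxint l hx.2
    have : F = P := by rw [hl, hl0]; simp
    rw [this] at hdim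
    omega
  refine ⟨i, Set.Subset.antisymm (fun x hx => ⟨hFP hx, hi x hx⟩) ?_⟩
  rintro x ⟨hxP, hxi⟩
  obtain ⟨x₀, hx₀⟩ := hne
  have hspan : vectorSpan ℝ F = (ℝ ∙ u i)ᗮ := by
    refine Submodule.eq_of_le_of_finrank_eq (vectorSpan_le_orthogonal hi) ?_
    have h1 := finrank_orthogonal_span_singleton_add_one hui
    rw [dim, direction_affineSpan] at hdim
    omega
  have hFl : ∀ y ∈ F, l y = l x₀ := fun y hy => by
    rw [hl] at hy hx₀
    exact le_antisymm (hx₀.2 y hy.1) (hy.2 x₀ hx₀.1)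
  have hlx : l (x - x₀) = 0 := by
    refine inner_eq_zero_of_mem_vectorSpan hFl ?_
    rw [hspan, Submodule.mem_orthogonal_singleton_iff_inner_right, inner_sub_right, hxi, hi x₀ hx₀,
      sub_self]
  rw [map_sub, sub_eq_zero] at hlx
  rw [hl] at hx₀ ⊢
  exact ⟨hxP, fun y hy => hlx ▸ hx₀.2 y hy⟩

/-- A full-dimensional polyhedron has at most as many facets as defining inequalities. -/
lemma encard_facets_le {m : ℕ} {u : Fin m → 𝔼} {β : Fin m → ℝ} {P : Set 𝔼}
    (hP : P = {x | ∀ i, inner ℝ (u i) x ≤ β i}) (hint : (interior P).Nonempty) :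
    (facets P).encard ≤ m := by
  have hsub : facets P ⊆ (fun i => {x ∈ P | inner ℝ (u i) x = β i}) '' Set.univ := by
    intro F hF
    obtain ⟨i, hi⟩ := exists_eq_of_mem_facets hP hint hF
    exact ⟨i, trivial, hi.symm⟩
  refine (Set.encard_le_encard hsub).trans ((Set.encard_image_le _ _).trans ?_)
  simp

/-- A full-dimensional polyhedron can be described by at most as many inequalities as it has
facets. -/
lemma exists_description_le_encard_facets {P : Set 𝔼} (hP : IsPolyhedron P)
    (hint : (interior P).Nonempty) :
    ∃ (m : ℕ) (u : Fin m → 𝔼) (β : Fin m → ℝ),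
      P = {x | ∀ i, inner ℝ (u i) x ≤ β i} ∧ (m : ℕ∞) ≤ (facets P).encard := by
  classical
  -- With the least number of inequalities, none is redundant.
  obtain ⟨u, β, hP'⟩ := Nat.find_spec hP
  have hmin : ∀ n < Nat.find hP, _ := fun n hn => Nat.find_min hP hn
  generalize Nat.find hP = m at u β hP' hmin
  refine ⟨m, u, β, hP', ?_⟩
  have hmem : ∀ x ∈ P, ∀ i, inner ℝ (u i) x ≤ β i := fun x hx => by rw [hP'] at hx; exact hx
  obtain ⟨x₀, hx₀⟩ := hint
  have hx₀P := interior_subset hx₀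
  have hred : ∀ i, ∃ y, (∀ j, j ≠ i → inner ℝ (u j) y ≤ β j) ∧ β i < inner ℝ (u i) y := by
    intro i
    by_contra! hcon
    obtain ⟨n, rfl⟩ : ∃ n, m = n + 1 := ⟨m - 1, by have := i.pos; omega⟩
    refine hmin n (Nat.lt_succ_self n) ⟨fun j => u (i.succAbove j), fun j => β (i.succAbove j), ?_⟩
    refine Set.Subset.antisymm (fun x hx j => hmem x hx _) fun x hx => ?_
    have hx' : ∀ j, j ≠ i → inner ℝ (u j) x ≤ β j := fun j hj => by
      obtain ⟨k, rfl⟩ := Fin.exists_succAbove_eq hj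
      exact hx k
    rw [hP']
    intro j
    by_cases hj : j = i
    · exact hj ▸ hcon x hx'
    · exact hx' j hj
  have hu : ∀ i, u i ≠ 0 := fun i h0 => by
    obtain ⟨y, -, hy⟩ := hred i
    have := hmem x₀ hx₀P i
    rw [h0, inner_zero_left] at hy this
    linarith
  have hlt : ∀ i, inner ℝ (u i) x₀ < β i := fun i => by
    refine lt_of_le_of_ne (hmem x₀ hx₀P i) fun heq => hu i ?_
    have := eq_zero_of_forall_le_of_mem_interior hx₀ (innerSL ℝ (u i)) fun y hy => by
      simpa [heq] using hmem y hy i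
    have h2 := congrArg (fun l : 𝔼 →L[ℝ] ℝ => l (u i)) this
    simpa using h2
  -- The segment from `x₀` to a point violating only constraint `i` crosses that hyperplane at a
  -- point strict for all other constraints.
  have hz : ∀ i, ∃ z, inner ℝ (u i) z = β i ∧ ∀ j, j ≠ i → inner ℝ (u j) z < β j := by
    intro i
    obtain ⟨y, hy, hyi⟩ := hred i
    have h0 := hlt i
    have hpos : 0 < inner ℝ (u i) y - inner ℝ (u i) x₀ := by linarith
    set t := (β i - inner ℝ (u i) x₀) / (inner ℝ (u i) y - inner ℝ (u i) x₀) with ht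
    have ht0 : 0 ≤ t := div_nonneg (by linarith) hpos.le
    have ht1 : t < 1 := (div_lt_one hpos).2 (by linarith)
    have htm : t * (inner ℝ (u i) y - inner ℝ (u i) x₀) = β i - inner ℝ (u i) x₀ :=
      div_mul_cancel₀ _ hpos.ne'
    have hval : ∀ j, inner ℝ (u j) ((1 - t) • x₀ + t • y)
        = (1 - t) * inner ℝ (u j) x₀ + t * inner ℝ (u j) y := fun j => by
      rw [inner_add_right, inner_smul_right, inner_smul_right]
    refine ⟨(1 - t) • x₀ + t • y, ?_, fun j hj => ?_⟩
    · rw [hval]; linarith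
    · rw [hval]
      have h1 := mul_lt_mul_of_pos_left (hlt j) (sub_pos.2 ht1)
      have h2 := mul_le_mul_of_nonneg_left (hy j hj) ht0
      linarith
  choose z hzi hzj using hz
  have hzP : ∀ i, z i ∈ P := fun i => by
    rw [hP']
    intro j
    by_cases hj : j = i
    · rw [hj, hzi]
    · exact (hzj i j hj).le
  let G : Fin m → Set 𝔼 := fun i => {x ∈ P | inner ℝ (u i) x = β i}
  have hG : ∀ i, G i ∈ facets P := by
    intro i
    refine ⟨⟨z i, hzP i, hzi i⟩, fun _ => ⟨innerSL ℝ (u i), ?_⟩, ?_⟩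
    · ext x
      refine and_congr_right fun hx => ⟨fun h y hy => ?_, fun h => ?_⟩
      · simpa [h] using hmem y hy i
      · exact le_antisymm (hmem x hx i) (by simpa [hzi i] using h (z i) (hzP i))
    · have hspan : vectorSpan ℝ (G i) = (ℝ ∙ u i)ᗮ := by
        refine le_antisymm (vectorSpan_le_orthogonal fun x hx => hx.2) fun v hv => ?_
        rw [Submodule.mem_orthogonal_singleton_iff_inner_right] at hv
        have hline : ∀ t : ℝ, inner ℝ (u i) (z i + t • v) = β i := fun t => by
          rw [inner_add_right, inner_smul_right, hv, hzi, mul_zero, add_zero]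
        have hev : ∀ᶠ y in 𝓝 (z i), ∀ j, j ≠ i → inner ℝ (u j) y ≤ β j := by
          refine Filter.eventually_all.2 fun j => ?_
          by_cases hj : j = i
          · exact Filter.Eventually.of_forall fun y h => absurd hj h
          · exact (eventually_inner_le (hzj i j hj)).mono fun y h _ => h
        -- Restricting to `t > 0` allows dividing by `t` below.
        have hcont : Filter.Tendsto (fun t : ℝ => z i + t • v) (𝓝[>] 0) (𝓝 (z i)) := by
          have : Continuous fun t : ℝ => z i + t • v := by fun_prop
          simpa using (this.tendsto 0).mono_left (nhdsWithin_le_nhds (s := Set.Ioi 0))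
        obtain ⟨t, ht, ht0⟩ := ((hcont.eventually hev).and self_mem_nhdsWithin).exists
        have hmemG : z i + t • v ∈ G i := by
          refine ⟨?_, hline t⟩
          rw [hP']
          intro j
          by_cases hj : j = i
          · rw [hj, hline]
          · exact ht j hj
        have := vsub_mem_vectorSpan ℝ hmemG (show z i ∈ G i from ⟨hzP i, hzi i⟩)
        rw [vsub_eq_sub, add_sub_cancel_left] at this
        exact (Submodule.smul_mem_iff _ (ne_of_gt ht0)).1 this
      rw [dim, direction_affineSpan, hspan, finrank_orthogonal_span_singleton_add_one (hu i),
        dim_eq_of_interior_nonempty ⟨x₀, hx₀⟩]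
  have hinj : Function.Injective G := by
    intro i j hij
    by_contra hne
    have : z i ∈ G j := hij ▸ ⟨hzP i, hzi i⟩
    exact (hzj i j (Ne.symm hne)).ne this.2
  calc (m : ℕ∞) = (Set.univ : Set (Fin m)).encard := by simp
    _ = (G '' Set.univ).encard := (hinj.encard_image _).symm
    _ ≤ (facets P).encard := Set.encard_le_encard (by rintro _ ⟨i, -, rfl⟩; exact hG i)

/-! ### Maximal free sets and erosion -/

/-- Every nonempty open convex set disjoint from `S` lies in a full-dimensional maximal `S`-free
set. -/
lemma exists_isFullDimMaximalFree_superset {S U : Set 𝔼} (hU : IsOpen U) (hUc : Convex ℝ U)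
    (hUne : U.Nonempty) (hUS : Disjoint U S) : ∃ M, IsFullDimMaximalFree S M ∧ U ⊆ M := by
  -- Zorn is applied to open sets, since chain unions of closed sets need not be closed; the closure
  -- of `V` has interior `V` by convexity.
  obtain ⟨V, hUV, hV⟩ := zorn_subset_nonempty {V : Set 𝔼 | IsOpen V ∧ Convex ℝ V ∧ Disjoint V S}
    (fun c hc hchain _ => ⟨⋃₀ c, ⟨isOpen_sUnion fun s hs => (hc hs).1,
      hchain.directedOn.convex_sUnion fun s hs => (hc hs).2.1,
      Set.disjoint_sUnion_left.2 fun s hs => (hc hs).2.2⟩, fun s hs => Set.subset_sUnion_of_mem hs⟩)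
    U ⟨hU, hUc, hUS⟩
  obtain ⟨hVo, hVc, hVS⟩ := hV.prop
  have hVne : V.Nonempty := hUne.mono hUV
  have hint : interior (closure V) = V := by
    rw [hVc.interior_closure_eq_interior_of_nonempty_interior (by rwa [hVo.interior_eq]),
      hVo.interior_eq]
  refine ⟨closure V, ⟨⟨⟨isClosed_closure, hVc.closure, by rwa [hint]⟩, ?_⟩, hVne.closure,
    dim_eq_of_interior_nonempty (by rwa [hint])⟩, hUV.trans subset_closure⟩
  rintro M ⟨hMcl, hMc, hMS⟩ hVM
  have hVM' : V ⊆ interior M := hVo.subset_interior_iff.2 (subset_closure.trans hVM)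
  have hMV : interior M ⊆ V := hV.le_of_ge ⟨isOpen_interior, hMc.interior, hMS⟩ hVM'
  calc M ⊆ closure M := subset_closure
    _ = closure (interior M) :=
      (hMc.closure_interior_eq_closure_of_nonempty_interior (hVne.mono hVM')).symm
    _ ⊆ closure V := closure_mono hMV

/-- Full-dimensional maximal `(C + S)`-free sets are erosions by `C` of full-dimensional maximal
`S`-free sets. -/
lemma exists_eq_erosion {S C L : Set 𝔼} (hC : Convex ℝ C) (hCne : C.Nonempty)
    (hL : IsFullDimMaximalFree (C + S) L) :
    ∃ M, IsFullDimMaximalFree S M ∧ L = {x | ∀ c ∈ C, x - c ∈ M} := by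
  obtain ⟨⟨⟨hLcl, hLc, hLS⟩, hLmax⟩, hLne, hLd⟩ := hL
  have hint := interior_nonempty_of_dim_eq hLc hLne hLd
  obtain ⟨M, hM, hLM⟩ := exists_isFullDimMaximalFree_superset (S := S) (U := interior L - C)
    isOpen_interior.sub_right (hLc.interior.sub hC) (hint.sub hCne) (by
      rw [Set.disjoint_left]
      rintro _ ⟨x, hx, c, hc, rfl⟩ hs
      exact Set.disjoint_left.1 hLS hx ⟨c, hc, _, hs, by simp⟩)
  refine ⟨M, hM, ?_⟩
  obtain ⟨⟨⟨hMcl, hMc, hMS⟩, -⟩, -, -⟩ := hM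
  have hN : {x | ∀ c ∈ C, x - c ∈ M} = ⋂ c ∈ C, (fun x => x - c) ⁻¹' M := by
    ext x; simp
  have hNcl : IsClosed {x | ∀ c ∈ C, x - c ∈ M} := by
    rw [hN]
    exact isClosed_biInter fun c _ => hMcl.preimage (by fun_prop)
  have hNc : Convex ℝ {x | ∀ c ∈ C, x - c ∈ M} := by
    rw [hN]
    refine convex_iInter₂ fun c _ => ?_
    simpa only [sub_eq_add_neg] using hMc.translate_preimage_left (-c)
  have hLN : L ⊆ {x | ∀ c ∈ C, x - c ∈ M} := by
    calc L ⊆ closure L := subset_closure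
      _ = closure (interior L) := (hLc.closure_interior_eq_closure_of_nonempty_interior hint).symm
      _ ⊆ {x | ∀ c ∈ C, x - c ∈ M} :=
        closure_minimal (fun x hx c hc => hLM (Set.sub_mem_sub hx hc)) hNcl
  refine Set.Subset.antisymm hLN (hLmax ⟨hNcl, hNc, ?_⟩ hLN)
  rw [Set.disjoint_left]
  rintro _ hx ⟨c, hc, s, hs, rfl⟩
  refine Set.disjoint_left.1 hMS ?_ hs
  -- Translating the interior of the erosion by `-c` gives an open subset of `M`.
  refine interior_maximal (s := M) (t := (fun y => c + y) ⁻¹' interior {x | ∀ c ∈ C, x - c ∈ M})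
    (fun y hy => ?_) (isOpen_interior.preimage (by fun_prop)) hx
  simpa using interior_subset hy c hc

lemma facetBound_add {S C : Set 𝔼} (hC : Convex ℝ C) (hCne : C.Nonempty) {k : ℕ}
    (hk : FacetBound S k) : FacetBound (C + S) k := by
  intro L hL
  obtain ⟨M, hM, hLM⟩ := exists_eq_erosion hC hCne hL
  obtain ⟨hMp, hMk⟩ := hk M hM
  obtain ⟨m, u, β, hMu, hm⟩ := exists_description_le_encard_facets hMp
    (interior_nonempty_of_dim_eq hM.1.prop.2.1 hM.2.1 hM.2.2)
  obtain ⟨x₀, hx₀⟩ := hL.2.1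
  have hle : ∀ x, x ∈ L ↔ ∀ i, ∀ c ∈ C, inner ℝ (u i) x - β i ≤ inner ℝ (u i) c := by
    intro x
    rw [hLM, hMu]
    simp only [Set.mem_ofPred_eq, inner_sub_right]
    exact ⟨fun h i c hc => by linarith [h c hc i], fun h c hc i => by linarith [h i c hc]⟩
  have hLu : L = {x | ∀ i, inner ℝ (u i) x ≤ β i + sInf ((fun c => inner ℝ (u i) c) '' C)} := by
    ext x
    rw [hle]
    refine forall_congr' fun i => ?_
    -- The point `x₀` of `L` bounds `u i` below on `C`, so the infimum is genuine.
    rw [← sub_le_iff_le_add', le_csInf_iff ⟨inner ℝ (u i) x₀ - β i, ?_⟩ (hCne.image _),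
      Set.forall_mem_image]
    rintro _ ⟨c, hc, rfl⟩
    exact (hle x₀).1 hx₀ i c hc
  exact ⟨⟨m, u, _, hLu⟩, (encard_facets_le hLu
    (interior_nonempty_of_dim_eq hL.1.prop.2.1 hL.2.1 hL.2.2)).trans (hm.trans hMk)⟩

theorem f_add_le {S C : Set 𝔼} (hC : Convex ℝ C) (hCne : C.Nonempty) : f (C + S) ≤ f S := by
  by_cases hL : ∃ L, IsFullDimMaximalFree (C + S) L
  · obtain ⟨L, hL'⟩ := hL
    obtain ⟨M, hM, -⟩ := exists_eq_erosion hC hCne hL'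
    rw [f, f, if_pos ⟨L, hL'⟩, if_pos ⟨M, hM⟩, WithBot.coe_le_coe]
    refine sInf_le_sInf ?_
    rintro _ ⟨k, hk, rfl⟩
    exact ⟨k, facetBound_add hC hCne hk, rfl⟩
  · rw [f, if_neg hL]
    exact bot_le

end HellyFacet

theorem theorem3 (d : ℕ) (S C : Set (EuclideanSpace ℝ (Fin d)))
    (hS : IsClosed S) (hC : Convex ℝ C) (hCne : C.Nonempty) :
    HellyFacet.h (C + S) ≤ ((HellyFacet.dim C + 1 : ℕ) : ℕ∞) * HellyFacet.h S ∧
      HellyFacet.f (C + S) ≤ HellyFacet.f S :=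
  ⟨HellyFacet.h_add_le hC hCne, HellyFacet.f_add_le hC hCne⟩
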